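/- **Theorem 3.1 (Extended polynomial method).** Let $n\ge 1$. A Gram matrix is a positive semidefinite complex matrix $M$ indexed by $\{0,1\}^n$ with unit diagonal. For $\varepsilon>1$ read $\sqrt{1-\varepsilon}$ as $0$. *Query complexity.* A quantum query algorithm acts on $\mathbb C^{n}\otimes\mathbb C^2\otimes\mathbb C^w$ for some finite $w$, with basis states $|i,b,a\rangle$. It starts in a fixed basis state and applies unitaries that do not depend on the input, interleaved with $T$ queries to the oracle $O_x:|i,b,a\rangle\mapsto(-1)^{b\,x_i}|i,b,a\rangle$; it ends, after a last unitary, in a state $|n_x\rangle$. It generates $M$ (coherently) with error $\varepsilon$ if, for some identification of its space with a tensor product $\mathcal H\otimes\mathcal H'$, some default basis state $|\bar 0\rangle\in\mathcal H'$, and some vectors $|m_x\rangle\in\mathcal H$ with $M_{x,x'}=\langle m_{x'}|m_x\rangle$ for all $x,x'$, one has $\operatorname{Re}\langle n_x|(|m_x\rangle\otimes|\bar 0\rangle)\ge\sqrt{1-\varepsilon}$ for every $x\in\{0,1\}^n$. The quantum query complexity $Q_\varepsilon(M)$ is the least number $T$ of queries of such an algorithm. *Degree.* For $S\subseteq\{1,\dots,n\}$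 let $|\chi_S\rangle=2^{-n/2}\sum_{x\in\{0,1\}^n}(-1)^{\sum_{i\in S}x_i}|x\rangle$, and for a Gram matrix $M$ let $$\deg(M)=\max\{|S| : \langle\chi_S|M|\chi_S\rangle\ne 0\}.$$ Let $F(\rho,\sigma)=\operatorname{tr}\sqrt{\sqrt\rho\,\sigma\sqrt\rho}$, let $F_H(A,B)=\min_{\|u\|=1}F(A\circ|u\rangle\langle u|,\,B\circ|u\rangle\langle u|)$ with $\circ$ the entrywise product, and for $\varepsilon\ge0$ let $$\widetilde{\deg}_\varepsilon(M)=\min\{\deg(N) : N \text{ a Gram matrix with } F_H(N,M)\ge\sqrt{1-\varepsilon}\}.$$ Then, for every Gram matrix $M$, $$Q_0(M)\ge\deg(M),\qquad\text{and}\qquad Q_\varepsilon(M)\ge\widetilde{\deg}_\varepsilon(M)\quad\text{for every }\varepsilon\ge0 .$$ -/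

import Mathlib

open scoped Matrix MatrixOrder ComplexOrder

namespace QQuery

/-- The inputs `x ∈ {0,1}^n`. -/
abbrev Input (n : ℕ) : Type := Fin n → Bool

/-- A normalized Gram matrix: positive semidefinite with unit diagonal (`A ∘ I = I`). -/
structure IsGram {X : Type*} [Fintype X] [DecidableEq X] (A : Matrix X X ℂ) : Prop where
  posSemidef : A.PosSemidef
  hadamard_one : A ⊙ (1 : Matrix X X ℂ) = 1

section Fidelity

variable {X : Type*} [Fintype X] [DecidableEq X]

/-- The fidelity `F(ρ, σ) = tr √(√ρ σ √ρ)`. -/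
noncomputable def fidelity (ρ σ : Matrix X X ℂ) : ℝ :=
  (CFC.sqrt (CFC.sqrt ρ * σ * CFC.sqrt ρ)).trace.re

/-- The Hadamard product fidelity: the minimum over unit vectors `u` of
`F(A ∘ |u⟩⟨u|, B ∘ |u⟩⟨u|)`. -/
noncomputable def hadamardFidelity (A B : Matrix X X ℂ) : ℝ :=
  ⨅ u : {u : X → ℂ // ∑ x, ‖u x‖ ^ 2 = 1},
    fidelity (A ⊙ Matrix.vecMulVec u.1 (star u.1)) (B ⊙ Matrix.vecMulVec u.1 (star u.1))

end Fidelity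

section Degree

variable {n : ℕ}

/-- The Fourier basis vector `χ_S = 2^(-n/2) ∑_x (-1)^(S·x) |x⟩`. -/
noncomputable def fourierVec (S : Finset (Fin n)) : Input n → ℂ := fun x =>
  (-1 : ℂ) ^ (S.filter fun i => x i = true).card / (Real.sqrt (2 ^ n) : ℂ)

open Classical in
/-- The zero-error extended polynomial bound: the largest `|S|` with `⟨χ_S|M|χ_S⟩ ≠ 0`. -/
noncomputable def xpolyZero (M : Matrix (Input n) (Input n) ℂ) : ℕ :=
  (Finset.univ.filter fun S : Finset (Fin n) =>
    star (fourierVec S) ⬝ᵥ (M *ᵥ fourierVec S) ≠ 0).sup Finset.card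

/-- The extended polynomial bound with error `ε`: the minimum of `xpolyZero N` over the Gram
matrices `N` with `F_H(N, M) ≥ √(1 - ε)`. -/
noncomputable def xpoly (ε : ℝ) (M : Matrix (Input n) (Input n) ℂ) : ℕ∞ :=
  ⨅ N ∈ {N : Matrix (Input n) (Input n) ℂ |
      IsGram N ∧ Real.sqrt (1 - ε) ≤ hadamardFidelity N M},
    (xpolyZero N : ℕ∞)

end Degree

section Algorithm

/-- Labels `(i, b, a)` of the computational basis of the algorithm's space: the query register
`|i, b⟩` and a work register of dimension `w`. -/
abbrev Label (n w : ℕ) : Type := Fin n × Bool × Fin w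

/-- The oracle `O_x : |i, b⟩ ↦ (-1)^(b · x_i) |i, b⟩`, acting as the identity on the
work register. -/
def oracle {n : ℕ} (w : ℕ) (x : Input n) : Matrix (Label n w) (Label n w) ℂ :=
  Matrix.diagonal fun k => (-1 : ℂ) ^ ((k.2.1).toNat * (x k.1).toNat)

/-- A quantum query algorithm with a work register of dimension `w`. It starts in a basis
state, applies a unitary, and then, for each entry `U` of `rounds`, makes one query and
applies `U`. None of these data depend on the input. -/
structure QueryAlgorithm (n w : ℕ) where
  init : Label n w
  first : Matrix.unitaryGroup (Label n w) ℂ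
  rounds : List (Matrix.unitaryGroup (Label n w) ℂ)

namespace QueryAlgorithm

variable {n w : ℕ}

/-- The number of queries made by the algorithm. -/
def queries (A : QueryAlgorithm n w) : ℕ := A.rounds.length

/-- The final state of the algorithm on input `x`. -/
def finalState (A : QueryAlgorithm n w) (x : Input n) : Label n w → ℂ :=
  A.rounds.foldl (fun ψ U => U.1 *ᵥ (oracle w x *ᵥ ψ)) (A.first.1 *ᵥ Pi.single A.init 1)

/-- The algorithm coherently generates the Gram matrix `M` with error `ε`: for some states
`m_x ∈ H = ℂ^d` with `M = ∑ ⟨m_{x'}|m_x⟩ |x⟩⟨x'|`, and with the algorithm's space identified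
with `H ⊗ H'`, `H' = ℂ^d'`, the final states `n_x` satisfy
`Re ⟨n_x| (|m_x⟩ ⊗ |z⟩) ≥ √(1 - ε)`, where `|z⟩` is a default basis state of `H'`.
Any further unitary identification of the two spaces is absorbed in the last unitary. -/
def Generates (A : QueryAlgorithm n w) (ε : ℝ) (M : Matrix (Input n) (Input n) ℂ) : Prop :=
  ∃ (d d' : ℕ) (e : Label n w ≃ Fin d × Fin d') (m : Input n → Fin d → ℂ) (z : Fin d'),
    (∀ x x', M x x' = star (m x') ⬝ᵥ m x) ∧
    ∀ x, Real.sqrt (1 - ε) ≤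
      (star (A.finalState x) ⬝ᵥ
        fun k => m x (e k).1 * (Pi.single z (1 : ℂ) : Fin d' → ℂ) (e k).2).re

end QueryAlgorithm

/-- The coherent quantum query complexity `Q_ε(M)`: the least number of queries of an algorithm,
with a work register of any finite dimension, that generates `M` with error `ε`. -/
noncomputable def queryComplexity {n : ℕ} (ε : ℝ) (M : Matrix (Input n) (Input n) ℂ) : ℕ∞ :=
  ⨅ (w : ℕ) (A : QueryAlgorithm n w) (_ : A.Generates ε M), (A.queries : ℕ∞)

end Algorithm

end QQuery

/-! A query multiplies each amplitude by `1` or by a sign `(-1)^{x_i}`, and the unitaries do not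
depend on `x`. So after `T` queries the amplitudes are polynomials of degree at most `T` in these
signs (`QueryAlgorithm.degreeLE_finalState`). If `N = ΨΨᴴ` is the Gram matrix of the final states,
then `⟨χ_S|N|χ_S⟩ = ‖Ψᴴχ_S‖²`, which vanishes for `|S| > T` (`xpolyZero_gramOf_le`).

With zero error the final states equal the padded targets, so `N = M`. With error `ε`, `N` is
admissible in the minimum defining `xpoly`: by the easy half of Uhlmann's theorem, overlaps of
vectors bound `F_H(N, M)` from below (`le_hadamardFidelity_gramOf`). -/

namespace QQuery

/-! ### Fourier degree of the final states -/

section Fourier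

variable {n : ℕ}

/-- The unnormalized parity character `(-1)^(S·x)`. -/
def parity (S : Finset (Fin n)) (x : Input n) : ℂ :=
  ∏ i ∈ S, if x i then -1 else 1

lemma fourierVec_eq_parity (S : Finset (Fin n)) (x : Input n) :
    fourierVec S x = parity S x / (Real.sqrt (2 ^ n) : ℂ) := by
  simp [fourierVec, parity, Finset.prod_ite]

lemma star_parity (S : Finset (Fin n)) (x : Input n) : star (parity S x) = parity S x := by
  unfold parity
  rw [star_prod]
  refine Finset.prod_congr rfl fun i _ => ?_
  split_ifs <;> simp

lemma sum_parity_eq_zero {S : Finset (Fin n)} (hS : S.Nonempty) : ∑ x, parity S x = 0 := by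
  have h := Finset.prod_univ_sum (fun _ : Fin n => (Finset.univ : Finset Bool))
    (fun i b => if i ∈ S then (if b then (-1 : ℂ) else 1) else 1)
  simp only [Fintype.piFinset_univ] at h
  have h' : ∀ x : Input n, parity S x =
      ∏ i, if i ∈ S then (if x i then (-1 : ℂ) else 1) else 1 := fun x => by
    simp [parity, Finset.prod_ite_mem]
  simp_rw [h']
  rw [← h]
  obtain ⟨i, hi⟩ := hS
  exact Finset.prod_eq_zero (Finset.mem_univ i) (by simp [hi])

/-- The sign squares to `1`, so multiplying by it toggles the membership of `i` in `S`. -/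
lemma exists_parity_mul_sign (S : Finset (Fin n)) (i : Fin n) :
    ∃ S' : Finset (Fin n), S.card ≤ S'.card + 1 ∧
      ∀ x, parity S x * (if x i then -1 else 1) = parity S' x := by
  by_cases hi : i ∈ S
  · refine ⟨S.erase i, ?_, fun x => ?_⟩
    · rw [Finset.card_erase_add_one hi]
    · unfold parity
      rw [← Finset.prod_erase_mul _ _ hi, mul_assoc]
      split_ifs <;> simp
  · refine ⟨insert i S, ?_, fun x => ?_⟩
    · rw [Finset.card_insert_of_notMem hi]; omega
    · unfold parity
      rw [Finset.prod_insert hi, mul_comm]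

/-- A family of vectors depends on the input through polynomials of degree at most `T`: its
Fourier coefficients at sets larger than `T` vanish. -/
def DegreeLE {ι : Type*} (T : ℕ) (ψ : Input n → ι → ℂ) : Prop :=
  ∀ k (S : Finset (Fin n)), T < S.card → ∑ x, parity S x * ψ x k = 0

lemma degreeLE_const {ι : Type*} (v : ι → ℂ) : DegreeLE 0 (fun _ : Input n => v) := by
  intro k S hS
  rw [← Finset.sum_mul, sum_parity_eq_zero (Finset.card_pos.mp hS), zero_mul]

lemma DegreeLE.mulVec {ι : Type*} [Fintype ι] {T : ℕ} {ψ : Input n → ι → ℂ}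
    (h : DegreeLE T ψ) (U : Matrix ι ι ℂ) : DegreeLE T fun x => U *ᵥ ψ x := by
  intro k S hS
  simp only [Matrix.mulVec, dotProduct, Finset.mul_sum]
  rw [Finset.sum_comm]
  refine Finset.sum_eq_zero fun j _ => ?_
  have := congrArg (U k j * ·) (h j S hS)
  simp only [Finset.mul_sum, mul_zero] at this
  rw [← this]
  exact Finset.sum_congr rfl fun x _ => by ring

lemma oracle_mulVec_apply {w : ℕ} (x : Input n) (v : Label n w → ℂ) (k : Label n w) :
    (oracle w x *ᵥ v) k = (if k.2.1 then (if x k.1 then -1 else 1) else 1) * v k := by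
  rw [oracle, Matrix.mulVec_diagonal]
  cases k.2.1 <;> cases x k.1 <;> simp

lemma DegreeLE.oracle {w T : ℕ} {ψ : Input n → Label n w → ℂ} (h : DegreeLE T ψ) :
    DegreeLE (T + 1) fun x => oracle w x *ᵥ ψ x := by
  intro k S hS
  simp only [oracle_mulVec_apply]
  cases k.2.1
  · simpa using h k S (by omega)
  · obtain ⟨S', hc, hS'⟩ := exists_parity_mul_sign S k.1
    simpa only [if_true, ← mul_assoc, hS'] using h k S' (by omega)

lemma QueryAlgorithm.degreeLE_finalState {w : ℕ} (A : QueryAlgorithm n w) :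
    DegreeLE A.queries A.finalState := by
  have key : ∀ (l : List (Matrix.unitaryGroup (Label n w) ℂ)) (T : ℕ)
      (ψ : Input n → Label n w → ℂ), DegreeLE T ψ →
      DegreeLE (T + l.length)
        fun x => l.foldl (fun φ U => U.1 *ᵥ (QQuery.oracle w x *ᵥ φ)) (ψ x) := by
    intro l
    induction l with
    | nil => intro T ψ h; simpa using h
    | cons U l ih =>
      intro T ψ h
      have := ih (T + 1) _ (h.oracle.mulVec U.1)
      simpa only [List.length_cons, List.foldl_cons, Nat.add_assoc, Nat.add_comm 1] using this
  have := key A.rounds 0 _ (degreeLE_const (A.first.1 *ᵥ Pi.single A.init 1))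
  rwa [Nat.zero_add] at this

/-- The Gram matrix `∑ ⟨ψ_{x'}|ψ_x⟩ |x⟩⟨x'|` of a family of vectors. -/
def gramOf {X ι : Type*} [Fintype ι] (ψ : X → ι → ℂ) : Matrix X X ℂ :=
  Matrix.of ψ * (Matrix.of ψ)ᴴ

lemma gramOf_apply {X ι : Type*} [Fintype ι] (ψ : X → ι → ℂ) (x x' : X) :
    gramOf ψ x x' = star (ψ x') ⬝ᵥ ψ x := by
  simp [gramOf, Matrix.mul_apply, dotProduct, mul_comm]

lemma gramOf_hadamard_vecMulVec {X ι : Type*} [Fintype ι] (ψ : X → ι → ℂ)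
    (u : X → ℂ) :
    gramOf ψ ⊙ Matrix.vecMulVec u (star u) = gramOf fun x => u x • ψ x := by
  ext x x'
  simp only [Matrix.hadamard_apply, gramOf_apply, Matrix.vecMulVec_apply, Pi.star_apply,
    star_smul, smul_dotProduct, dotProduct_smul, smul_eq_mul]
  ring

lemma isGram_gramOf {X ι : Type*} [Fintype X] [DecidableEq X] [Fintype ι] {ψ : X → ι → ℂ}
    (h : ∀ x, star (ψ x) ⬝ᵥ ψ x = 1) : IsGram (gramOf ψ) where
  posSemidef := Matrix.posSemidef_self_mul_conjTranspose _
  hadamard_one := by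
    ext x x'
    by_cases hx : x = x'
    · subst hx; simp [gramOf_apply, h]
    · simp [hx]

lemma xpolyZero_gramOf_le {ι : Type*} [Fintype ι] {T : ℕ} {ψ : Input n → ι → ℂ}
    (h : DegreeLE T ψ) : xpolyZero (gramOf ψ) ≤ T := by
  classical
  unfold xpolyZero
  refine Finset.sup_le fun S hS => ?_
  by_contra hT
  refine (Finset.mem_filter.mp hS).2 ?_
  -- Characters are real, so up to scale the entries are conjugates of Fourier coefficients of `ψ`.
  have hz : (Matrix.of ψ)ᴴ *ᵥ fourierVec S = 0 := by
    ext k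
    have := congrArg star (h k S (not_le.mp hT))
    simp only [star_sum, star_mul', star_parity, star_zero] at this
    simp only [Matrix.mulVec, dotProduct, Matrix.conjTranspose_apply, Matrix.of_apply,
      fourierVec_eq_parity, Pi.zero_apply]
    simp_rw [mul_div_assoc', ← Finset.sum_div, mul_comm (star _)]
    rw [this, zero_div]
  rw [gramOf, ← Matrix.mulVec_mulVec, hz, Matrix.mulVec_zero, dotProduct_zero]

end Fourier

/-! ### Unit norm and the equality case of Cauchy–Schwarz -/

section Norm

lemma star_mulVec_dotProduct_mulVec {ι : Type*} [Fintype ι] [DecidableEq ι]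
    {U : Matrix ι ι ℂ} (hU : Uᴴ * U = 1) (v : ι → ℂ) :
    star (U *ᵥ v) ⬝ᵥ (U *ᵥ v) = star v ⬝ᵥ v := by
  rw [Matrix.star_mulVec, ← Matrix.dotProduct_mulVec, Matrix.mulVec_mulVec, hU, Matrix.one_mulVec]

variable {n : ℕ}

lemma oracle_conjTranspose_mul_self (w : ℕ) (x : Input n) :
    (oracle w x)ᴴ * oracle w x = 1 := by
  rw [oracle, Matrix.diagonal_conjTranspose, Matrix.diagonal_mul_diagonal, ← Matrix.diagonal_one]
  refine congrArg Matrix.diagonal (funext fun ⟨i, b, a⟩ => ?_)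
  cases b <;> cases hx : x i <;> simp [hx]

lemma QueryAlgorithm.star_finalState_dotProduct {w : ℕ} (A : QueryAlgorithm n w) (x : Input n) :
    star (A.finalState x) ⬝ᵥ A.finalState x = 1 := by
  have key : ∀ (l : List (Matrix.unitaryGroup (Label n w) ℂ)) (v : Label n w → ℂ),
      star v ⬝ᵥ v = 1 →
      star (l.foldl (fun φ U => U.1 *ᵥ (oracle w x *ᵥ φ)) v) ⬝ᵥ
        l.foldl (fun φ U => U.1 *ᵥ (oracle w x *ᵥ φ)) v = 1 := by
    intro l
    induction l with
    | nil => intro v h; exact h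
    | cons U l ih =>
      intro v h
      refine ih _ ?_
      rw [star_mulVec_dotProduct_mulVec (Matrix.mem_unitaryGroup_iff'.mp U.2),
        star_mulVec_dotProduct_mulVec (oracle_conjTranspose_mul_self w x), h]
  refine key A.rounds _ ?_
  rw [star_mulVec_dotProduct_mulVec (Matrix.mem_unitaryGroup_iff'.mp A.first.2)]
  simp

/-- For unit vectors `‖u - v‖² = 2 - 2 Re⟨u|v⟩`. -/
lemma eq_of_one_le_re_dotProduct {ι : Type*} [Fintype ι] {u v : ι → ℂ}
    (hu : star u ⬝ᵥ u = 1) (hv : star v ⬝ᵥ v = 1) (h : 1 ≤ (star u ⬝ᵥ v).re) : u = v := by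
  have hvu : star v ⬝ᵥ u = star (star u ⬝ᵥ v) := by
    rw [← Matrix.star_dotProduct_star, star_star]
  have hle : star (u - v) ⬝ᵥ (u - v) ≤ 0 := by
    have h0 : 0 ≤ star (u - v) ⬝ᵥ (u - v) := dotProduct_star_self_nonneg _
    have him := (Complex.le_def.mp h0).2
    refine Complex.le_def.mpr ⟨?_, him.symm⟩
    simp only [star_sub, sub_dotProduct, dotProduct_sub, hu, hv, hvu]
    simp
    linarith
  exact sub_eq_zero.mp
    (dotProduct_star_self_eq_zero.mp (le_antisymm hle (dotProduct_star_self_nonneg _)))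

end Norm

/-! ### Lower bounds on the fidelity -/

section Fidelity

variable {X ι : Type*} [Fintype X] [DecidableEq X] [Fintype ι]

/-- A factor `A` of `R²`, with `R` positive semidefinite, is `R` times a contraction. -/
lemma exists_eq_mul_contraction {R : Matrix X X ℂ} (hR : R.PosSemidef) {A : Matrix X ι ℂ}
    (h : A * Aᴴ = R * R) :
    ∃ V : Matrix X ι ℂ, A = R * V ∧ (1 - V * Vᴴ).PosSemidef := by
  have hsa : IsSelfAdjoint R := hR.1
  have hcont : ∀ f : ℝ → ℝ, ContinuousOn f (spectrum ℝ R) := fun f =>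
    (Matrix.finite_real_spectrum (A := R)).continuousOn f
  -- As `0⁻¹ = 0`, this is the pseudo-inverse of `R`, and `R * Q` is the projection onto the range
  -- of `R`. The contraction is `V = Q * A`, with `V * Vᴴ = R * Q`.
  set Q : Matrix X X ℂ := cfc (fun t : ℝ => t⁻¹) R
  have hQs : Qᴴ = Q := cfc_predicate (R := ℝ) (fun t : ℝ => t⁻¹) R
  have hRQR : R * Q * R = R := by
    have e : cfc (fun t : ℝ => t * t⁻¹ * t) R = R * Q * R := by
      rw [cfc_mul _ _ R (hcont _) (hcont _), cfc_mul _ _ R (hcont _) (hcont _), cfc_id' ℝ R hsa]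
    rw [← e]
    simp only [mul_inv_mul_cancel]
    exact cfc_id' ℝ R hsa
  have hQR : Q * R = R * Q := ((Commute.refl R).cfc_real _).eq
  have hP : (1 - R * Q)ᴴ = 1 - R * Q := by
    rw [Matrix.conjTranspose_sub, Matrix.conjTranspose_mul, hQs, hR.1.eq, hQR,
      Matrix.conjTranspose_one]
  have hPR : (1 - R * Q) * R = 0 := by rw [Matrix.sub_mul, hRQR, Matrix.one_mul, sub_self]
  refine ⟨Q * A, ?_, ?_⟩
  · have hz : ((1 - R * Q) * A) * ((1 - R * Q) * A)ᴴ = 0 := by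
      rw [Matrix.conjTranspose_mul, Matrix.mul_assoc, ← Matrix.mul_assoc A, h, Matrix.mul_assoc R,
        ← Matrix.mul_assoc, hPR, Matrix.zero_mul]
    have := Matrix.self_mul_conjTranspose_eq_zero.mp hz
    rw [Matrix.sub_mul, Matrix.one_mul, sub_eq_zero, Matrix.mul_assoc] at this
    exact this
  · have : 1 - Q * A * (Q * A)ᴴ = (1 - R * Q)ᴴ * (1 - R * Q) := by
      have e : Q * A * (Q * A)ᴴ = R * Q := by
        rw [Matrix.conjTranspose_mul, hQs, Matrix.mul_assoc Q, ← Matrix.mul_assoc A, h,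
          Matrix.mul_assoc R, ← hQR, ← Matrix.mul_assoc R, hRQR]
      rw [e, hP, Matrix.mul_sub, Matrix.mul_one, ← Matrix.mul_assoc, hPR, Matrix.zero_mul, sub_zero]
    rw [this]
    exact Matrix.posSemidef_conjTranspose_mul_self _

/-- With `G = CᴴC`, the difference of the traces is `tr C(1 - VVᴴ)Cᴴ ≥ 0`. -/
lemma re_trace_conjTranspose_mul_mul_le {G : Matrix X X ℂ} (hG : G.PosSemidef)
    {V : Matrix X ι ℂ} (hV : (1 - V * Vᴴ).PosSemidef) :
    (Vᴴ * G * V).trace.re ≤ G.trace.re := by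
  obtain ⟨C, hC⟩ := CStarAlgebra.nonneg_iff_eq_star_mul_self.mp hG.nonneg
  have h := (hV.mul_mul_conjTranspose_same C).trace_nonneg
  have h' : (C * (1 - V * Vᴴ) * Cᴴ).trace = G.trace - (Vᴴ * G * V).trace := by
    rw [Matrix.mul_sub, Matrix.sub_mul, Matrix.trace_sub, Matrix.mul_one, Matrix.trace_mul_comm C,
      ← Matrix.star_eq_conjTranspose C, ← hC, Matrix.trace_mul_comm (C * _),
      ← Matrix.mul_assoc (star C), ← hC, ← Matrix.mul_assoc, Matrix.trace_mul_comm _ (Vᴴ),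
      Matrix.mul_assoc]
  rw [h', Complex.le_def] at h
  simpa using h.1

/-- The easy half of Uhlmann's theorem. -/
lemma re_trace_mul_conjTranspose_le_fidelity (A B : Matrix X ι ℂ) :
    (A * Bᴴ).trace.re ≤ fidelity (A * Aᴴ) (B * Bᴴ) := by
  set R := CFC.sqrt (A * Aᴴ) with hRdef
  have hR : R.PosSemidef := Matrix.nonneg_iff_posSemidef.mp (CFC.sqrt_nonneg _)
  have hRR : A * Aᴴ = R * R :=
    (CFC.sqrt_mul_sqrt_self _ (Matrix.posSemidef_self_mul_conjTranspose A).nonneg).symm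
  have hD : R * (B * Bᴴ) * R = R * B * (R * B)ᴴ := by
    rw [Matrix.conjTranspose_mul, hR.1.eq]; simp only [Matrix.mul_assoc]
  have hF : fidelity (A * Aᴴ) (B * Bᴴ) = (CFC.sqrt (R * B * (R * B)ᴴ)).trace.re := by
    rw [fidelity, ← hRdef, hD]
  set G := CFC.sqrt (R * B * (R * B)ᴴ) with hGdef
  have hG : G.PosSemidef := Matrix.nonneg_iff_posSemidef.mp (CFC.sqrt_nonneg _)
  have hGG : R * B * (R * B)ᴴ = G * G :=
    (CFC.sqrt_mul_sqrt_self _ (Matrix.posSemidef_self_mul_conjTranspose _).nonneg).symm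
  obtain ⟨V, hAV, hV⟩ := exists_eq_mul_contraction hR hRR
  obtain ⟨W, hBW, hW⟩ := exists_eq_mul_contraction hG hGG
  rw [hF]
  have e : (A * Bᴴ).trace = (Wᴴ * G * V).trace := by
    have : Bᴴ * R = Wᴴ * G := by
      simpa [Matrix.conjTranspose_mul, hR.1.eq, hG.1.eq] using congrArg Matrix.conjTranspose hBW
    rw [← this, Matrix.mul_assoc, ← hAV, Matrix.trace_mul_comm]
  have e' : (Vᴴ * G * W).trace = star (Wᴴ * G * V).trace := by
    rw [← Matrix.trace_conjTranspose]
    simp only [Matrix.conjTranspose_mul, Matrix.conjTranspose_conjTranspose, hG.1.eq,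
      Matrix.mul_assoc]
  -- Expanding the square gives `2 Re tr(WᴴGV) ≤ tr(VᴴGV) + tr(WᴴGW)` in real parts, and each term
  -- on the right is at most `tr G`.
  have hpos := (hG.conjTranspose_mul_mul_same (V - W)).trace_nonneg
  have h1 := re_trace_conjTranspose_mul_mul_le hG hV
  have h2 := re_trace_conjTranspose_mul_mul_le hG hW
  have h3 := (Complex.le_def.mp hpos).1
  simp only [Matrix.conjTranspose_sub, Matrix.sub_mul, Matrix.mul_sub, Matrix.trace_sub, e'] at h3
  simp at h3
  rw [e]
  linarith

lemma le_hadamardFidelity_gramOf [Nonempty X] {ψ φ : X → ι → ℂ} {c : ℝ}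
    (h : ∀ x, c ≤ (star (ψ x) ⬝ᵥ φ x).re) : c ≤ hadamardFidelity (gramOf ψ) (gramOf φ) := by
  have : Nonempty {u : X → ℂ // ∑ x, ‖u x‖ ^ 2 = 1} := by
    obtain ⟨x⟩ := ‹Nonempty X›
    refine ⟨⟨Pi.single x 1, ?_⟩⟩
    rw [Finset.sum_eq_single x] <;> simp +contextual
  refine le_ciInf fun ⟨u, hu⟩ => ?_
  rw [gramOf_hadamard_vecMulVec, gramOf_hadamard_vecMulVec]
  refine le_trans ?_ (re_trace_mul_conjTranspose_le_fidelity _ _)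
  -- The trace averages the overlaps with weights `‖u x‖²`, which sum to `1`.
  have e : (Matrix.of (fun x => u x • ψ x) * (Matrix.of fun x => u x • φ x)ᴴ).trace.re
      = ∑ x, ‖u x‖ ^ 2 * (star (ψ x) ⬝ᵥ φ x).re := by
    rw [Matrix.trace, Complex.re_sum]
    refine Finset.sum_congr rfl fun x _ => ?_
    have : (Matrix.of (fun x => u x • ψ x) * (Matrix.of fun x => u x • φ x)ᴴ).diag x
        = ((‖u x‖ ^ 2 : ℝ) : ℂ) * star (star (ψ x) ⬝ᵥ φ x) := by
      rw [← Matrix.star_dotProduct_star, star_star, Complex.ofReal_pow, ← Complex.mul_conj']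
      simp only [Matrix.diag_apply, Matrix.mul_apply, Matrix.of_apply, Matrix.conjTranspose_apply,
        Pi.smul_apply, smul_eq_mul, star_mul', dotProduct, Pi.star_apply, Finset.mul_sum,
        starRingEnd_apply]
      exact Finset.sum_congr rfl fun k _ => by ring
    rw [this, Complex.re_ofReal_mul]
    simp
  rw [e]
  calc c = ∑ x, ‖u x‖ ^ 2 * c := by rw [← Finset.sum_mul, hu, one_mul]
    _ ≤ _ := Finset.sum_le_sum fun x _ => mul_le_mul_of_nonneg_left (h x) (sq_nonneg _)

end Fidelity

/-! ### From coherent generation to the degree bounds -/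

section Generation

variable {n w : ℕ}

lemma IsGram.apply_self {X : Type*} [Fintype X] [DecidableEq X] {M : Matrix X X ℂ}
    (hM : IsGram M) (x : X) : M x x = 1 := by
  simpa using congrFun (congrFun hM.hadamard_one x) x

/-- Padding the target vectors with the default state does not change their Gram matrix. -/
lemma QueryAlgorithm.Generates.exists_gramOf_eq {A : QueryAlgorithm n w} {ε : ℝ}
    {M : Matrix (Input n) (Input n) ℂ} (h : A.Generates ε M) :
    ∃ φ : Input n → Label n w → ℂ, M = gramOf φ ∧
      ∀ x, Real.sqrt (1 - ε) ≤ (star (A.finalState x) ⬝ᵥ φ x).re := by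
  obtain ⟨d, d', e, m, z, hm, hA⟩ := h
  refine ⟨_, ?_, hA⟩
  ext x x'
  rw [gramOf_apply, hm]
  simp only [dotProduct, Pi.star_apply, star_mul']
  rw [← e.symm.sum_comp]
  simp only [Equiv.apply_symm_apply, Fintype.sum_prod_type]
  refine Finset.sum_congr rfl fun a _ => ?_
  rw [Finset.sum_eq_single z] <;> simp +contextual

lemma QueryAlgorithm.Generates.xpolyZero_le {A : QueryAlgorithm n w}
    {M : Matrix (Input n) (Input n) ℂ} (hM : IsGram M) (h : A.Generates 0 M) :
    xpolyZero M ≤ A.queries := by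
  obtain ⟨φ, rfl, hφ⟩ := h.exists_gramOf_eq
  have : A.finalState = φ := funext fun x =>
    eq_of_one_le_re_dotProduct (A.star_finalState_dotProduct x)
      (by rw [← gramOf_apply, hM.apply_self]) (by simpa using hφ x)
  exact xpolyZero_gramOf_le (this ▸ A.degreeLE_finalState)

lemma QueryAlgorithm.Generates.xpoly_le {A : QueryAlgorithm n w} {ε : ℝ}
    {M : Matrix (Input n) (Input n) ℂ} (h : A.Generates ε M) :
    xpoly ε M ≤ A.queries := by
  obtain ⟨φ, rfl, hφ⟩ := h.exists_gramOf_eq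
  refine (iInf₂_le (gramOf A.finalState) ⟨isGram_gramOf A.star_finalState_dotProduct,
    le_hadamardFidelity_gramOf hφ⟩).trans ?_
  exact_mod_cast xpolyZero_gramOf_le A.degreeLE_finalState

end Generation

end QQuery

theorem theorem3p1 (n : ℕ) (hn : 0 < n)
    (M : Matrix (QQuery.Input n) (QQuery.Input n) ℂ) (hM : QQuery.IsGram M) :
    (QQuery.xpolyZero M : ℕ∞) ≤ QQuery.queryComplexity 0 M ∧
      ∀ ε : ℝ, 0 ≤ ε → QQuery.xpoly ε M ≤ QQuery.queryComplexity ε M := by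
  refine ⟨?_, fun ε _ => ?_⟩
  · exact le_iInf fun w => le_iInf fun A => le_iInf fun h => by exact_mod_cast h.xpolyZero_le hM
  · exact le_iInf fun w => le_iInf fun A => le_iInf fun h => h.xpoly_le
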